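/- Consider a stochastic bandit with $K\ge 1$ actions, where action $i$ has a fixed reward distribution on $[0,1]$ with mean $\mu_i$, and let $\mu^*=\max_i\mu_i$. In each round $t=1,\dots,T$ the learner selects an action $i_t$, a reward $r_t(i_t)$ is drawn from the distribution of $i_t$ independently of the past, and an attacker, who knows the actions and true rewards $i_1,r_1(i_1),\dots,i_t,r_t(i_t)$ and may randomize, adds a contamination $\epsilon_t\in[-r_t(i_t),\,1-r_t(i_t)]$, so that the learner observes only $r^o_t=r_t(i_t)+\epsilon_t\in[0,1]$. The learner runs UCB on the observed rewards: in round $t\le K$ it selects action $t$, and in round $t>K$ it selects an action maximizing $\hat\mu_{t-1}(i)+\sqrt{8\log t/N_{t-1}(i)}$ (ties broken in any way that uses only information available before round $t$), where $N_{t-1}(i)$ is the number of rounds up to $t-1$ in which $i$ was selected and $\hat\mu_{t-1}(i)$ is the average of the rewards observed in these rounds. The regret is $R^{UCB}(T)=T\mu^*-\mathbb{E}\big[\sum_{t=1}^T r_t(i_t)\big]$. Let $0<\epsilon<1$. If for every horizon $T$ the expected amount of contamination satisfies $\mathbb{E}\big[\sum_{t=1}^T|\epsilon_t|\big]\le(\log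 T)^{1-\epsilon}$, then $R^{UCB}(T)=o(T)$, uniformly over all such attackers: for every bandit instance and every $\epsilon\in(0,1)$ there is a function $g$ with $g(T)/T\to0$ as $T\to\infty$ such that $|R^{UCB}(T)|\le g(T)$ for every $T$ and every attacker whose expected amount of contamination over the $T$ rounds is at most $(\log T)^{1-\epsilon}$. -/

import Mathlib

open MeasureTheory ProbabilityTheory Filter Asymptotics

/-- A stochastic bandit instance with `K` actions: every action has a reward distribution,
a probability measure carried by the interval `[0, 1]`. -/
structure StochasticBandit (K : ℕ) where
  law : Fin K → Measure ℝ
  isProbabilityMeasure_law : ∀ i, IsProbabilityMeasure (law i)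
  law_mem_Icc : ∀ i, ∀ᵐ x ∂(law i), x ∈ Set.Icc (0 : ℝ) 1

namespace StochasticBandit

variable {K : ℕ}

/-- The expected reward `μ_i` of action `i`. -/
noncomputable def mean (ν : StochasticBandit K) (i : Fin K) : ℝ := ∫ x, x ∂(ν.law i)

/-- The expected reward `μ_{i*} = max_i μ_i` of a best action. -/
noncomputable def bestMean (ν : StochasticBandit K) : ℝ := ⨆ i, ν.mean i

end StochasticBandit

/-- `N_t(i)`: the number of rounds `n ∈ {1, …, t}` in which action `i` is selected, for the
sequence of actions `a 1, a 2, …`. -/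
def pulls {K : ℕ} (a : ℕ → Fin K) (t : ℕ) (i : Fin K) : ℕ :=
  ((Finset.Icc 1 t).filter (fun n => a n = i)).card

/-- The empirical mean of action `i` until round `t`, where `o n` is the reward observed by the
learner in round `n`. -/
noncomputable def empMean {K : ℕ} (a : ℕ → Fin K) (o : ℕ → ℝ) (t : ℕ) (i : Fin K) : ℝ :=
  (∑ n ∈ (Finset.Icc 1 t).filter (fun n => a n = i), o n) / (pulls a t i : ℝ)

/-- The upper confidence bound of action `i` used for the selection in round `t`. -/
noncomputable def ucbIndex {K : ℕ} (a : ℕ → Fin K) (o : ℕ → ℝ) (t : ℕ) (i : Fin K) : ℝ :=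
  empMean a o (t - 1) i + Real.sqrt (8 * Real.log (t : ℝ) / (pulls a (t - 1) i : ℝ))

/-- The actions `a 1, …, a T` are selected by UCB from the observed rewards `o 1, …, o T`:
round robin in the rounds `t ≤ K` (in round `t` the `t`-th action), and afterwards an action that
maximizes the upper confidence bound, with ties broken in any way. -/
def FollowsUCB {K : ℕ} (T : ℕ) (a : ℕ → Fin K) (o : ℕ → ℝ) : Prop :=
  ∀ t, 1 ≤ t → t ≤ T →
    (t ≤ K → (a t : ℕ) + 1 = t) ∧
    (K < t → ∀ j, ucbIndex a o t j ≤ ucbIndex a o t (a t))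

/-- `T` rounds of UCB on the instance `ν` under a data poisoning attack.

In round `t`, `r t i` is the true reward of action `i`, `I t` is the selected action, and `c t` is
the contamination that the attacker adds to the true reward `r t (I t)` of the selected action.
The σ-algebra `ℱ t` is the information present at the end of round `t`. It contains the
selected actions and their true rewards up to round `t`. If it is generated by them, the attacker
is a deterministic (measurable) function of them; a larger `ℱ t` also admits a randomized attacker
(and randomized tie-breaking). -/
structure AttackedUCBRun {K : ℕ} (ν : StochasticBandit K) (T : ℕ)
    {Ω : Type*} {mΩ : MeasurableSpace Ω} (P : Measure Ω) (ℱ : Filtration ℕ mΩ)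
    (r : ℕ → Fin K → Ω → ℝ) (I : ℕ → Ω → Fin K) (c : ℕ → Ω → ℝ) : Prop where
  /-- Rewards of action `i` have the distribution of action `i`. -/
  measurable_reward : ∀ t, 1 ≤ t → t ≤ T → ∀ i, Measurable (r t i)
  map_reward : ∀ t, 1 ≤ t → t ≤ T → ∀ i, P.map (r t i) = ν.law i
  /-- Rewards are independent of everything that happened in earlier rounds. -/
  indep_reward : ∀ t, 1 ≤ t → t ≤ T → ∀ i,
    Indep (MeasurableSpace.comap (r t i) inferInstance) (ℱ (t - 1)) P
  /-- The action of round `t` is selected before the rewards of round `t` are drawn. -/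
  measurable_action : ∀ t, 1 ≤ t → t ≤ T → Measurable[ℱ (t - 1)] (I t)
  /-- The true reward of the selected action is known to the attacker in round `t`. -/
  measurable_realized : ∀ t, 1 ≤ t → t ≤ T → Measurable[ℱ t] (fun ω => r t (I t ω) ω)
  /-- The contamination is determined by what is known to the attacker in round `t`. -/
  measurable_contamination : ∀ t, 1 ≤ t → t ≤ T → Measurable[ℱ t] (c t)
  /-- Observed rewards stay in `[0, 1]`. -/
  contamination_mem : ∀ t, 1 ≤ t → t ≤ T → ∀ ω,
    c t ω ∈ Set.Icc (-(r t (I t ω) ω)) (1 - r t (I t ω) ω)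
  /-- The learner runs UCB on the observed rewards. -/
  followsUCB : ∀ ω, FollowsUCB T (fun t => I t ω) (fun t => r t (I t ω) ω + c t ω)

/-- The expected amount of contamination `𝔼[∑_{t=1}^T |c_t|]`. -/
noncomputable def expectedContamination {Ω : Type*} {mΩ : MeasurableSpace Ω} (P : Measure Ω)
    (T : ℕ) (c : ℕ → Ω → ℝ) : ℝ :=
  ∫ ω, ∑ t ∈ Finset.Icc 1 T, |c t ω| ∂P

/-- The regret `T μ_{i*} - 𝔼[∑_{t=1}^T r_t(i_t)]`, measured with the true rewards. -/
noncomputable def regret {K : ℕ} (ν : StochasticBandit K) {Ω : Type*} {mΩ : MeasurableSpace Ω}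
    (P : Measure Ω) (T : ℕ) (r : ℕ → Fin K → Ω → ℝ) (I : ℕ → Ω → Fin K) : ℝ :=
  (T : ℝ) * ν.bestMean - ∫ ω, ∑ t ∈ Finset.Icc 1 T, r t (I t ω) ω ∂P

/-! The bonus `√(8 log t / N)` is twice the width `√(2 log t / N)` that concentration needs. The
spare half absorbs a total contamination of at most `log t`, which moves an empirical mean by at
most `log t / N`. So when both arms are concentrated, a suboptimal arm with gap `Δ` is not selected
once it has more than `72 log t / Δ ^ 2` pulls (`FollowsUCB.ne_of_concentrated`).

Concentration of the true rewards survives the adaptive attacker, because each reward is independent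
of the past: Hoeffding's lemma yields an exponential supermartingale
(`lintegral_exp_centeredSum_le`), and a union bound over the number of pulls gives
`measure_deviation_le`.

Only rounds `t > √T` are analysed; there `log t ≥ log T / 2`. By Markov, the contamination exceeds
`log T / 2` with probability at most `2 (log T) ^ (-ε)`. On that event the whole horizon may be
lost, but this costs only `T * o(1)`. All other terms are of order `√T` or `log T`, and no bound
depends on the attacker. -/

/-- The sum over the first `t` rounds of the deviations `x n - m` in the rounds that select `i`. -/
noncomputable def centeredSum {K : ℕ} (a : ℕ → Fin K) (x : ℕ → ℝ) (m : ℝ) (t : ℕ) (i : Fin K) : ℝ :=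
  ∑ n ∈ (Finset.Icc 1 t).filter (fun n => a n = i), (x n - m)

/-! ### Pathwise analysis of UCB under bounded contamination. -/

section Deterministic

variable {K : ℕ}

lemma pulls_zero (a : ℕ → Fin K) (i : Fin K) : pulls a 0 i = 0 := by
  simp [pulls]

lemma centeredSum_zero (a : ℕ → Fin K) (x : ℕ → ℝ) (m : ℝ) (i : Fin K) :
    centeredSum a x m 0 i = 0 := by
  simp [centeredSum]

lemma pulls_eq_sum (a : ℕ → Fin K) (t : ℕ) (i : Fin K) :
    pulls a t i = ∑ n ∈ Finset.Icc 1 t, if a n = i then 1 else 0 := by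
  rw [pulls, Finset.card_filter]

lemma centeredSum_eq_sum (a : ℕ → Fin K) (x : ℕ → ℝ) (m : ℝ) (t : ℕ) (i : Fin K) :
    centeredSum a x m t i = ∑ n ∈ Finset.Icc 1 t, if a n = i then x n - m else 0 := by
  rw [centeredSum, Finset.sum_filter]

lemma pulls_succ (a : ℕ → Fin K) (t : ℕ) (i : Fin K) :
    pulls a (t + 1) i = pulls a t i + if a (t + 1) = i then 1 else 0 := by
  rw [pulls_eq_sum, pulls_eq_sum, Finset.sum_Icc_succ_top (by omega)]

lemma centeredSum_succ (a : ℕ → Fin K) (x : ℕ → ℝ) (m : ℝ) (t : ℕ) (i : Fin K) :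
    centeredSum a x m (t + 1) i
      = centeredSum a x m t i + if a (t + 1) = i then x (t + 1) - m else 0 := by
  rw [centeredSum_eq_sum, centeredSum_eq_sum, Finset.sum_Icc_succ_top (by omega)]

lemma pulls_le (a : ℕ → Fin K) (t : ℕ) (i : Fin K) : pulls a t i ≤ t := by
  refine (Finset.card_filter_le _ _).trans ?_
  simp

lemma pulls_pos {T t : ℕ} {a : ℕ → Fin K} {o : ℕ → ℝ} (h : FollowsUCB T a o) (hKt : K ≤ t)
    (htT : t ≤ T) (i : Fin K) : 0 < pulls a t i := by
  refine Finset.card_pos.2 ⟨i + 1, ?_⟩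
  have h1 := (h (i + 1) (by omega) (by omega)).1 (by omega)
  simp only [Finset.mem_filter, Finset.mem_Icc]
  exact ⟨⟨by omega, by omega⟩, Fin.ext (by omega)⟩

lemma sum_corrupted_eq (a : ℕ → Fin K) (x c : ℕ → ℝ) (m : ℝ) (t : ℕ) (i : Fin K) :
    ∑ n ∈ (Finset.Icc 1 t).filter (fun n => a n = i), (x n + c n)
      = pulls a t i * m + centeredSum a x m t i
        + ∑ n ∈ (Finset.Icc 1 t).filter (fun n => a n = i), c n := by
  simp [centeredSum, pulls, Finset.sum_add_distrib]

lemma abs_sum_filter_le (a : ℕ → Fin K) (c : ℕ → ℝ) {t T : ℕ} (h : t ≤ T) (i : Fin K) :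
    |∑ n ∈ (Finset.Icc 1 t).filter (fun n => a n = i), c n| ≤ ∑ n ∈ Finset.Icc 1 T, |c n| := by
  refine (Finset.abs_sum_le_sum_abs _ _).trans
    (Finset.sum_le_sum_of_subset_of_nonneg ?_ fun _ _ _ => abs_nonneg _)
  exact (Finset.filter_subset _ _).trans (Finset.Icc_subset_Icc le_rfl h)

lemma sqrt_eight_div {N L : ℝ} (hN : 0 < N) :
    √(8 * L / N) = 2 * √(2 * N * L) / N := by
  have h : 8 * L / N = (2 / N) ^ 2 * (2 * N * L) := by field_simp; ring
  rw [h, Real.sqrt_mul (sq_nonneg _), Real.sqrt_sq (by positivity)]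
  ring

/-- If `N ≤ 8 * L`, the bonus alone is at least `1`. Otherwise `L ≤ √(2 * N * L)`, so one half of
the bonus covers the deviation and the other half covers `B`. -/
lemma le_mean_add_bonus {N L μ S B : ℝ} (hN : 0 < N) (hμ : μ ≤ 1) (hL : 0 ≤ L) (hS0 : 0 ≤ S)
    (hB : B ≤ L) (hS : N * μ - √(2 * N * L) - B ≤ S) : μ ≤ S / N + √(8 * L / N) := by
  rcases le_total N (8 * L) with h | h
  · have h1 : 1 ≤ √(8 * L / N) := by
      rw [Real.one_le_sqrt, le_div_iff₀ hN]
      linarith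
    have h2 : 0 ≤ S / N := by positivity
    linarith
  · rw [sqrt_eight_div hN, ← add_div, le_div_iff₀ hN]
    have h1 : L ≤ √(2 * N * L) := by
      apply Real.le_sqrt_of_sq_le
      nlinarith
    linarith

lemma mean_add_bonus_lt {N L μ Δ S B : ℝ} (hN : 0 < N) (hΔ0 : 0 < Δ) (hΔ1 : Δ ≤ 1) (hL : 0 ≤ L)
    (hB : B ≤ L) (hS : S ≤ N * μ + √(2 * N * L) + B) (hNΔ : 72 * L / Δ ^ 2 < N) :
    S / N + √(8 * L / N) < μ + Δ := by
  rw [sqrt_eight_div hN, ← add_div, div_lt_iff₀ hN]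
  rw [div_lt_iff₀ (by positivity)] at hNΔ
  -- Deviation and bonus add up to three widths, hence less than `N * Δ / 2`; this is where `72 = 2
  -- * 6 ^ 2` comes from. The remaining half leaves ample room for `B`.
  have h1 : √(2 * N * L) < N * Δ / 6 := by
    rw [Real.sqrt_lt' (by positivity)]
    nlinarith
  have h2 : 72 * L < N * Δ := by nlinarith [mul_pos hN hΔ0]
  nlinarith [mul_pos hN hΔ0]

/-- In a round in which both arms are concentrated around their means and the contamination is
small, UCB does not select an arm that was pulled often and has a smaller mean. -/
lemma FollowsUCB.ne_of_concentrated {T t : ℕ} {a : ℕ → Fin K} {x c : ℕ → ℝ}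
    (h : FollowsUCB T a (fun n => x n + c n)) (hKt : K < t) (htT : t ≤ T)
    (hnn : ∀ n, 1 ≤ n → n ≤ T → 0 ≤ x n + c n)
    (hc : ∑ n ∈ Finset.Icc 1 T, |c n| ≤ Real.log t) {i j : Fin K} {μi μj : ℝ}
    (hij : μi < μj) (hi0 : 0 ≤ μi) (hj1 : μj ≤ 1)
    (hj : -√(2 * pulls a (t - 1) j * Real.log t) ≤ centeredSum a x μj (t - 1) j)
    (hi : centeredSum a x μi (t - 1) i ≤ √(2 * pulls a (t - 1) i * Real.log t))
    (hN : 72 * Real.log t / (μj - μi) ^ 2 < pulls a (t - 1) i) : a t ≠ i := by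
  intro hat
  have hmax := (h t (by omega) htT).2 hKt j
  have hL : 0 ≤ Real.log t := Real.log_natCast_nonneg t
  have hpos : ∀ k, (0 : ℝ) < pulls a (t - 1) k := fun k => by
    exact_mod_cast pulls_pos h (by omega) (by omega) k
  have habs := fun k => abs_le.1 (abs_sum_filter_le a c (show t - 1 ≤ T by omega) k)
  have h1 : μj ≤ ucbIndex a (fun n => x n + c n) t j := by
    refine le_mean_add_bonus (hpos j) hj1 hL ?_ hc ?_
    · refine Finset.sum_nonneg fun n hn => ?_
      simp only [Finset.mem_filter, Finset.mem_Icc] at hn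
      exact hnn n hn.1.1 (by omega)
    · rw [sum_corrupted_eq a x c μj]
      linarith [(habs j).1]
  have h2 : ucbIndex a (fun n => x n + c n) t i < μi + (μj - μi) := by
    refine mean_add_bonus_lt (hpos i) (by linarith) (by linarith) hL hc ?_ hN
    rw [sum_corrupted_eq a x c μi]
    linarith [(habs i).2]
  rw [hat] at hmax
  linarith

lemma card_filter_pulls_le (a : ℕ → Fin K) (i : Fin K) (n T : ℕ) :
    ((Finset.Icc 1 T).filter (fun t => a t = i ∧ pulls a (t - 1) i ≤ n)).card ≤ n + 1 := by
  induction T with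
  | zero => simp
  | succ T ih =>
    by_cases h : a (T + 1) = i ∧ pulls a T i ≤ n
    · rw [← Finset.insert_Icc_right_eq_Icc_add_one (by omega), Finset.filter_insert,
        if_pos (by simpa using h)]
      -- If the last round counts, at most `n` pulls precede it, and these include all earlier
      -- counted rounds.
      refine (Finset.card_insert_le _ _).trans (Nat.succ_le_succ (le_trans ?_ h.2))
      exact Finset.card_le_card (Finset.monotone_filter_right _ fun _ _ h => h.1)
    · rw [← Finset.insert_Icc_right_eq_Icc_add_one (by omega), Finset.filter_insert,
        if_neg (by simpa using h)]
      exact ih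

/-- Only late selections of an already well-sampled arm need a probabilistic bound; the other rounds
number at most `m + (n + 1)`. -/
lemma pulls_le_add_sum (a : ℕ → Fin K) (i : Fin K) (m n T : ℕ) :
    pulls a T i ≤ m + (n + 1)
      + ((Finset.Ioc m T).filter (fun t => a t = i ∧ n < pulls a (t - 1) i)).card := by
  have hsub : (Finset.Icc 1 T).filter (fun t => a t = i) ⊆
      Finset.Icc 1 m ∪ (Finset.Icc 1 T).filter (fun t => a t = i ∧ pulls a (t - 1) i ≤ n)
        ∪ (Finset.Ioc m T).filter (fun t => a t = i ∧ n < pulls a (t - 1) i) := by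
    intro t ht
    simp only [Finset.mem_filter, Finset.mem_Icc, Finset.mem_union, Finset.mem_Ioc] at ht ⊢
    rcases le_or_gt t m with h | h
    · exact Or.inl (Or.inl ⟨ht.1.1, h⟩)
    · rcases le_or_gt (pulls a (t - 1) i) n with h' | h'
      · exact Or.inl (Or.inr ⟨ht.1, ht.2, h'⟩)
      · exact Or.inr ⟨⟨h, ht.1.2⟩, ht.2, h'⟩
  refine (Finset.card_le_card hsub).trans ((Finset.card_union_le _ _).trans ?_)
  gcongr
  refine (Finset.card_union_le _ _).trans ?_
  gcongr
  · simp
  · exact card_filter_pulls_le a i n T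

end Deterministic
-- Concentration of the true rewards under adaptive selection.
open scoped ENNReal

namespace StochasticBandit

variable {K : ℕ} (ν : StochasticBandit K)

lemma mean_mem_Icc (i : Fin K) : ν.mean i ∈ Set.Icc (0 : ℝ) 1 := by
  have := ν.isProbabilityMeasure_law i
  have hint : Integrable (fun x => x) (ν.law i) :=
    Integrable.of_mem_Icc 0 1 aemeasurable_id (ν.law_mem_Icc i)
  refine ⟨integral_nonneg_of_ae ((ν.law_mem_Icc i).mono fun x hx => hx.1), ?_⟩
  refine (integral_mono_ae hint (integrable_const (1 : ℝ))
    ((ν.law_mem_Icc i).mono fun x hx => hx.2)).trans_eq ?_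
  simp

/-- Hoeffding's lemma for an interval of length `1`, normalised as one step of the supermartingale.
-/
lemma lintegral_exp_sub_mean_le (i : Fin K) (l : ℝ) :
    ∫⁻ x, ENNReal.ofReal (Real.exp (l * (x - ν.mean i) - l ^ 2 / 8)) ∂(ν.law i) ≤ 1 := by
  have := ν.isProbabilityMeasure_law i
  have h := hasSubgaussianMGF_of_mem_Icc (X := fun x => x) aemeasurable_id (ν.law_mem_Icc i)
  have hint := h.integrable_exp_mul l
  have hmgf := h.mgf_le l
  have hint' : Integrable (fun x => Real.exp (l * (x - ν.mean i) - l ^ 2 / 8)) (ν.law i) := by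
    simp_rw [Real.exp_sub _ (l ^ 2 / 8)]
    exact hint.div_const _
  rw [← ofReal_integral_eq_lintegral_ofReal hint' (ae_of_all _ fun x => (Real.exp_pos _).le),
    ENNReal.ofReal_le_one]
  simp_rw [Real.exp_sub _ (l ^ 2 / 8)]
  rw [integral_div, div_le_one (Real.exp_pos _)]
  refine hmgf.trans_eq ?_
  congr 1
  simp
  ring

end StochasticBandit

namespace AttackedUCBRun

variable {K : ℕ} {ν : StochasticBandit K} {T : ℕ} {Ω : Type*} {mΩ : MeasurableSpace Ω}
  {P : Measure Ω} {ℱ : Filtration ℕ mΩ} {r : ℕ → Fin K → Ω → ℝ} {I : ℕ → Ω → Fin K}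
  {c : ℕ → Ω → ℝ}

lemma measurableSet_action_eq (h : AttackedUCBRun ν T P ℱ r I c) {t : ℕ} (h1 : 1 ≤ t) (hT : t ≤ T)
    (i : Fin K) : MeasurableSet[ℱ (t - 1)] {ω | I t ω = i} :=
  h.measurable_action t h1 hT (measurableSet_singleton i)

lemma measurable_pulls (h : AttackedUCBRun ν T P ℱ r I c) {t : ℕ} (hT : t ≤ T) (i : Fin K) :
    Measurable[ℱ t] (fun ω => (pulls (fun n => I n ω) t i : ℝ)) := by
  simp_rw [pulls_eq_sum]
  push_cast
  refine Finset.measurable_sum (m := ℱ t) _ fun n hn => ?_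
  rw [Finset.mem_Icc] at hn
  exact Measurable.ite (ℱ.mono (by omega) _ (h.measurableSet_action_eq hn.1 (by omega) i))
    measurable_const measurable_const

lemma measurable_centeredSum (h : AttackedUCBRun ν T P ℱ r I c) {t : ℕ} (hT : t ≤ T) (i : Fin K)
    (m : ℝ) :
    Measurable[ℱ t] (fun ω => centeredSum (fun n => I n ω) (fun n => r n (I n ω) ω) m t i) := by
  simp_rw [centeredSum_eq_sum]
  refine Finset.measurable_sum (m := ℱ t) _ fun n hn => ?_
  rw [Finset.mem_Icc] at hn
  refine Measurable.ite (ℱ.mono (by omega) _ (h.measurableSet_action_eq hn.1 (by omega) i))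
    (Measurable.sub_const ?_ _) measurable_const
  exact (h.measurable_realized n hn.1 (by omega)).mono (ℱ.mono hn.2) le_rfl

lemma lintegral_mul_reward (h : AttackedUCBRun ν T P ℱ r I c) {t : ℕ} (h1 : 1 ≤ t) (hT : t ≤ T)
    (i : Fin K) {Y : Ω → ℝ≥0∞} (hY : Measurable[ℱ (t - 1)] Y) {f : ℝ → ℝ≥0∞} (hf : Measurable f) :
    ∫⁻ ω, Y ω * f (r t i ω) ∂P = (∫⁻ ω, Y ω ∂P) * ∫⁻ x, f x ∂(ν.law i) := by
  have hr := h.measurable_reward t h1 hT i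
  rw [← h.map_reward t h1 hT i, lintegral_map hf hr]
  exact lintegral_mul_eq_lintegral_mul_lintegral_of_independent_measurableSpace (ℱ.le (t - 1))
    hr.comap_le (h.indep_reward t h1 hT i).symm hY (hf.comp (comap_measurable _))

/-- The exponential process of the centered rewards of an arm is a supermartingale started
in `1`. -/
lemma lintegral_exp_centeredSum_le [IsProbabilityMeasure P] (h : AttackedUCBRun ν T P ℱ r I c)
    (i : Fin K) (l : ℝ) {t : ℕ} (hT : t ≤ T) :
    ∫⁻ ω, ENNReal.ofReal (Real.exp
      (l * centeredSum (fun n => I n ω) (fun n => r n (I n ω) ω) (ν.mean i) t i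
        - l ^ 2 / 8 * pulls (fun n => I n ω) t i)) ∂P ≤ 1 := by
  induction t with
  | zero => simp [pulls_zero, centeredSum_zero]
  | succ t ih =>
    have ih := ih (by omega)
    set Z : Ω → ℝ≥0∞ := fun ω => ENNReal.ofReal (Real.exp
      (l * centeredSum (fun n => I n ω) (fun n => r n (I n ω) ω) (ν.mean i) t i
        - l ^ 2 / 8 * pulls (fun n => I n ω) t i)) with hZ
    have hZm : Measurable[ℱ t] Z :=
      ENNReal.measurable_ofReal.comp (Real.measurable_exp.comp
        (((h.measurable_centeredSum (by omega) i _).const_mul l).sub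
          ((h.measurable_pulls (by omega) i).const_mul _)))
    -- The selection of round `t + 1` is known at time `t`. On `A` a fresh independent reward
    -- contributes a factor of mean at most `1`; off `A` nothing changes.
    have hA : MeasurableSet[ℱ t] {ω | I (t + 1) ω = i} :=
      h.measurableSet_action_eq (t := t + 1) (by omega) hT i
    set A : Set Ω := {ω | I (t + 1) ω = i} with hAdef
    set f : ℝ → ℝ≥0∞ := fun x => ENNReal.ofReal (Real.exp (l * (x - ν.mean i) - l ^ 2 / 8)) with hf
    have hfm : Measurable f := by fun_prop
    have hZA : Measurable[ℱ t] (A.indicator Z) := hZm.indicator hA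
    have hZA' : Measurable[ℱ t] (Aᶜ.indicator Z) := hZm.indicator hA.compl
    calc _ = ∫⁻ ω, (A.indicator Z ω * f (r (t + 1) i ω) + Aᶜ.indicator Z ω) ∂P := by
          refine lintegral_congr fun ω => ?_
          rw [pulls_succ, centeredSum_succ]
          by_cases hω : I (t + 1) ω = i
          · have hω' : ω ∈ A := hω
            simp only [hω, if_true, Set.indicator_of_mem hω', hZ, hf, add_zero,
              Set.indicator_of_notMem (fun hn => hn hω' : ω ∉ Aᶜ)]
            rw [← ENNReal.ofReal_mul (Real.exp_pos _).le, ← Real.exp_add]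
            congr 2
            push_cast
            ring
          · have hω' : ω ∉ A := hω
            simp [hω, Set.indicator_of_notMem hω', Set.indicator_of_mem (show ω ∈ Aᶜ from hω'), hZ]
      _ = (∫⁻ ω, A.indicator Z ω ∂P) * ∫⁻ x, f x ∂(ν.law i) + ∫⁻ ω, Aᶜ.indicator Z ω ∂P := by
          rw [lintegral_add_right _ (hZA'.mono (ℱ.le t) le_rfl),
            h.lintegral_mul_reward (t := t + 1) (by omega) hT i hZA hfm]
      _ ≤ (∫⁻ ω, A.indicator Z ω ∂P) * 1 + ∫⁻ ω, Aᶜ.indicator Z ω ∂P := by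
          gcongr
          exact ν.lintegral_exp_sub_mean_le i l
      _ = ∫⁻ ω, Z ω ∂P := by
          rw [mul_one, lintegral_indicator (ℱ.le t _ hA), lintegral_indicator (ℱ.le t _ hA.compl),
            lintegral_add_compl _ (ℱ.le t _ hA)]
      _ ≤ 1 := ih

/-- The deviation event of an arm with a fixed number of pulls. -/
lemma measure_deviation_pulls_le [IsProbabilityMeasure P] (h : AttackedUCBRun ν T P ℱ r I c)
    (i : Fin K) {s L : ℝ} (hs : s ^ 2 = 1) (hL : 0 ≤ L) {t : ℕ} (hT : t ≤ T) (k : ℕ) :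
    P.real {ω | pulls (fun n => I n ω) t i = k ∧ √(2 * pulls (fun n => I n ω) t i * L)
      < s * centeredSum (fun n => I n ω) (fun n => r n (I n ω) ω) (ν.mean i) t i}
      ≤ Real.exp (-(4 * L)) := by
  -- Without pulls both sides of the strict inequality are `0`, so the event is empty.
  rcases Nat.eq_zero_or_pos k with rfl | hk
  · refine le_trans (le_of_eq ?_) (Real.exp_pos _).le
    rw [measureReal_eq_zero_iff]
    convert measure_empty (μ := P)
    ext ω
    simp only [Set.mem_ofPred_eq, Set.mem_empty_iff_false, iff_false, not_and]
    intro h0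
    have : centeredSum (fun n => I n ω) (fun n => r n (I n ω) ω) (ν.mean i) t i = 0 := by
      rw [centeredSum, Finset.card_eq_zero.1 h0, Finset.sum_empty]
    simp [this, h0]
  have hk' : (0 : ℝ) < k := by exact_mod_cast hk
  set w : ℝ := √(2 * k * L) with hw
  have hw2 : w ^ 2 = 2 * k * L := Real.sq_sqrt (by positivity)
  have hw0 : 0 ≤ w := Real.sqrt_nonneg _
  -- The slope `4 * w / k` maximises `l * w - l ^ 2 * k / 8`, with value `2 * w ^ 2 / k = 4 * L`;
  -- the sign `s` selects the tail.
  have hE := h.lintegral_exp_centeredSum_le i (s * (4 * w / k)) hT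
  set Z : Ω → ℝ≥0∞ := fun ω => ENNReal.ofReal (Real.exp
      (s * (4 * w / k) * centeredSum (fun n => I n ω) (fun n => r n (I n ω) ω) (ν.mean i) t i
        - (s * (4 * w / k)) ^ 2 / 8 * pulls (fun n => I n ω) t i)) with hZ
  have hZm : Measurable Z :=
    ENNReal.measurable_ofReal.comp (Real.measurable_exp.comp
      ((((h.measurable_centeredSum hT i _).mono (ℱ.le t) le_rfl).const_mul _).sub
        (((h.measurable_pulls hT i).mono (ℱ.le t) le_rfl).const_mul _)))
  have hM := (mul_meas_ge_le_lintegral (μ := P) hZm (ENNReal.ofReal (Real.exp (4 * L)))).trans hE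
  have hsub : {ω | pulls (fun n => I n ω) t i = k ∧ √(2 * pulls (fun n => I n ω) t i * L)
      < s * centeredSum (fun n => I n ω) (fun n => r n (I n ω) ω) (ν.mean i) t i}
      ⊆ {ω | ENNReal.ofReal (Real.exp (4 * L)) ≤ Z ω} := by
    rintro ω ⟨h1, h2⟩
    rw [h1, ← hw] at h2
    refine ENNReal.ofReal_le_ofReal (Real.exp_le_exp.2 ?_)
    rw [h1]
    set M := centeredSum (fun n => I n ω) (fun n => r n (I n ω) ω) (ν.mean i) t i
    have e1 : (s * (4 * w / k)) ^ 2 / 8 * k = 4 * L := by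
      rw [mul_pow, hs, div_pow, mul_pow, hw2]
      field_simp
      ring
    have e2 : 4 * w / k * w = 8 * L := by
      have : 4 * w / k * w = 4 * w ^ 2 / k := by ring
      rw [this, hw2]
      field_simp
      ring
    have e3 : 4 * w / k * w ≤ 4 * w / k * (s * M) := by gcongr
    rw [e1]
    nlinarith
  have hP : ENNReal.ofReal (Real.exp (4 * L)) * P {ω | ENNReal.ofReal (Real.exp (4 * L)) ≤ Z ω}
      ≤ 1 := hM
  have hP' := ENNReal.toReal_mono ENNReal.one_ne_top hP
  rw [ENNReal.toReal_mul, ENNReal.toReal_ofReal (Real.exp_pos _).le, ENNReal.toReal_one] at hP'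
  refine (measureReal_mono hsub).trans ?_
  rw [Real.exp_neg, ← one_div, le_div_iff₀ (Real.exp_pos _), mul_comm]
  exact hP'

lemma measure_deviation_le [IsProbabilityMeasure P] (h : AttackedUCBRun ν T P ℱ r I c)
    (i : Fin K) {s L : ℝ} (hs : s ^ 2 = 1) (hL : 0 ≤ L) {t : ℕ} (hT : t ≤ T) :
    P.real {ω | √(2 * pulls (fun n => I n ω) t i * L)
      < s * centeredSum (fun n => I n ω) (fun n => r n (I n ω) ω) (ν.mean i) t i}
      ≤ (t + 1) * Real.exp (-(4 * L)) := by
  have hsub : {ω | √(2 * pulls (fun n => I n ω) t i * L)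
      < s * centeredSum (fun n => I n ω) (fun n => r n (I n ω) ω) (ν.mean i) t i}
      ⊆ ⋃ k ∈ Finset.range (t + 1), {ω | pulls (fun n => I n ω) t i = k ∧
        √(2 * pulls (fun n => I n ω) t i * L)
          < s * centeredSum (fun n => I n ω) (fun n => r n (I n ω) ω) (ν.mean i) t i} := by
    intro ω hω
    simp only [Set.mem_iUnion, Finset.mem_range]
    exact ⟨_, Nat.lt_succ_of_le (pulls_le (fun n => I n ω) t i), rfl, hω⟩
  refine (measureReal_mono hsub (measure_ne_top _ _)).trans ((measureReal_biUnion_finset_le _ _).trans ?_)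
  refine (Finset.sum_le_card_nsmul _ _ _ fun k _ =>
    h.measure_deviation_pulls_le i hs hL hT k).trans_eq ?_
  simp

end AttackedUCBRun

/-! ### Regret decomposition over the arms. -/

namespace StochasticBandit

variable {K : ℕ} (ν : StochasticBandit K)

lemma mean_le_bestMean (i : Fin K) : ν.mean i ≤ ν.bestMean :=
  le_ciSup (Set.finite_range ν.mean).bddAbove i

lemma exists_mean_eq_bestMean (hK : 1 ≤ K) : ∃ i, ν.mean i = ν.bestMean := by
  have : Nonempty (Fin K) := ⟨⟨0, hK⟩⟩
  exact exists_eq_ciSup_of_finite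

end StochasticBandit

lemma integral_card_filter {Ω : Type*} {mΩ : MeasurableSpace Ω} {P : Measure Ω}
    [IsFiniteMeasure P] (s : Finset ℕ) (p : ℕ → Ω → Prop) [∀ ω, DecidablePred fun t => p t ω]
    (hp : ∀ t ∈ s, MeasurableSet {ω | p t ω}) :
    Integrable (fun ω => ((s.filter (fun t => p t ω)).card : ℝ)) P ∧
      ∫ ω, ((s.filter (fun t => p t ω)).card : ℝ) ∂P = ∑ t ∈ s, P.real {ω | p t ω} := by
  have heq : ∀ ω, ((s.filter (fun t => p t ω)).card : ℝ)
      = ∑ t ∈ s, {ω | p t ω}.indicator (fun _ => (1 : ℝ)) ω := by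
    intro ω
    rw [Finset.card_filter]
    push_cast
    refine Finset.sum_congr rfl fun t _ => ?_
    by_cases h : p t ω <;> simp [h]
  have hint : ∀ t ∈ s, Integrable ({ω | p t ω}.indicator (fun _ => (1 : ℝ))) P := fun t ht =>
    (integrable_const 1).indicator (hp t ht)
  simp_rw [heq]
  refine ⟨integrable_finsetSum _ hint, ?_⟩
  rw [integral_finsetSum _ hint]
  exact Finset.sum_congr rfl fun t ht => integral_indicator_one (hp t ht)

namespace AttackedUCBRun

variable {K : ℕ} {ν : StochasticBandit K} {T : ℕ} {Ω : Type*} {mΩ : MeasurableSpace Ω}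
  {P : Measure Ω} {ℱ : Filtration ℕ mΩ} {r : ℕ → Fin K → Ω → ℝ} {I : ℕ → Ω → Fin K}
  {c : ℕ → Ω → ℝ}

lemma ae_reward_mem (h : AttackedUCBRun ν T P ℱ r I c) {t : ℕ} (h1 : 1 ≤ t) (hT : t ≤ T)
    (i : Fin K) : ∀ᵐ ω ∂P, r t i ω ∈ Set.Icc (0 : ℝ) 1 := by
  have := ν.law_mem_Icc i
  rw [← h.map_reward t h1 hT i] at this
  exact ae_of_ae_map (h.measurable_reward t h1 hT i).aemeasurable this

lemma integrable_reward [IsProbabilityMeasure P] (h : AttackedUCBRun ν T P ℱ r I c) {t : ℕ}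
    (h1 : 1 ≤ t) (hT : t ≤ T) (i : Fin K) : Integrable (r t i) P :=
  Integrable.of_mem_Icc 0 1 (h.measurable_reward t h1 hT i).aemeasurable (h.ae_reward_mem h1 hT i)

lemma integrable_abs_contamination [IsProbabilityMeasure P] (h : AttackedUCBRun ν T P ℱ r I c)
    {t : ℕ} (h1 : 1 ≤ t) (hT : t ≤ T) : Integrable (fun ω => |c t ω|) P := by
  have hm : Measurable (c t) := (h.measurable_contamination t h1 hT).mono (ℱ.le t) le_rfl
  refine (Integrable.of_mem_Icc (-1) 1 hm.aemeasurable ?_).abs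
  filter_upwards [ae_all_iff.2 (h.ae_reward_mem h1 hT)] with ω hω
  have h2 := h.contamination_mem t h1 hT ω
  have h3 := hω (I t ω)
  exact ⟨by linarith [h2.1, h3.2], by linarith [h2.2, h3.1]⟩

lemma integrable_indicator_reward [IsProbabilityMeasure P] (h : AttackedUCBRun ν T P ℱ r I c)
    {t : ℕ} (h1 : 1 ≤ t) (hT : t ≤ T) (i : Fin K) :
    Integrable ({ω | I t ω = i}.indicator (r t i)) P :=
  (h.integrable_reward h1 hT i).indicator (ℱ.le _ _ (h.measurableSet_action_eq h1 hT i))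

lemma integral_indicator_reward [IsProbabilityMeasure P] (h : AttackedUCBRun ν T P ℱ r I c)
    {t : ℕ} (h1 : 1 ≤ t) (hT : t ≤ T) (i : Fin K) :
    ∫ ω, {ω | I t ω = i}.indicator (r t i) ω ∂P = P.real {ω | I t ω = i} * ν.mean i := by
  have hA := h.measurableSet_action_eq h1 hT i
  have hr := h.measurable_reward t h1 hT i
  set A : Set Ω := {ω | I t ω = i}
  have hXm : Measurable[ℱ (t - 1)] (A.indicator (fun _ => (1 : ℝ))) :=
    measurable_const.indicator hA
  -- The selection is decided before the reward is drawn, so the two are independent.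
  have hind : IndepFun (A.indicator (fun _ => (1 : ℝ))) (r t i) P := by
    rw [IndepFun_iff_Indep]
    exact indep_of_indep_of_le_left (h.indep_reward t h1 hT i).symm hXm.comap_le
  have key := hind.integral_fun_mul_eq_mul_integral
    (hXm.mono (ℱ.le _) le_rfl).aestronglyMeasurable hr.aestronglyMeasurable
  have hmean : ∫ ω, r t i ω ∂P = ν.mean i := by
    rw [StochasticBandit.mean, ← h.map_reward t h1 hT i]
    exact (integral_map hr.aemeasurable aestronglyMeasurable_id).symm
  rw [hmean] at key
  have hone : ∫ ω, A.indicator (fun _ => (1 : ℝ)) ω ∂P = P.real A :=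
    integral_indicator_one (ℱ.le _ _ hA)
  rw [hone] at key
  rw [← key]
  refine integral_congr_ae (ae_of_all _ fun ω => ?_)
  by_cases hω : ω ∈ A <;> simp [hω]

lemma sum_measure_action_eq [IsProbabilityMeasure P] (h : AttackedUCBRun ν T P ℱ r I c)
    {t : ℕ} (h1 : 1 ≤ t) (hT : t ≤ T) : ∑ i, P.real {ω | I t ω = i} = 1 := by
  have hm : Measurable (I t) := (h.measurable_action t h1 hT).mono (ℱ.le _) le_rfl
  have := sum_measureReal_preimage_singleton (μ := P) Finset.univ (f := I t)
    fun i _ => hm (measurableSet_singleton i)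
  rw [Finset.coe_univ, Set.preimage_univ, probReal_univ] at this
  exact this

/-- The regret decomposition over the arms. -/
lemma regret_eq [IsProbabilityMeasure P] (h : AttackedUCBRun ν T P ℱ r I c) :
    regret ν P T r I
      = ∑ i, (ν.bestMean - ν.mean i) * ∑ t ∈ Finset.Icc 1 T, P.real {ω | I t ω = i} := by
  have hdec : ∀ t, (fun ω => r t (I t ω) ω)
      = fun ω => ∑ i, {ω | I t ω = i}.indicator (r t i) ω := by
    intro t
    ext ω
    simp [Set.indicator_apply]
  have hint : ∀ t ∈ Finset.Icc 1 T, Integrable (fun ω => r t (I t ω) ω) P := by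
    intro t ht
    rw [Finset.mem_Icc] at ht
    rw [hdec]
    exact integrable_finsetSum _ fun i _ => h.integrable_indicator_reward ht.1 ht.2 i
  have hval : ∀ t ∈ Finset.Icc 1 T, ∫ ω, r t (I t ω) ω ∂P
      = ∑ i, P.real {ω | I t ω = i} * ν.mean i := by
    intro t ht
    rw [Finset.mem_Icc] at ht
    rw [hdec, integral_finsetSum _ fun i _ => h.integrable_indicator_reward ht.1 ht.2 i]
    exact Finset.sum_congr rfl fun i _ => h.integral_indicator_reward ht.1 ht.2 i
  have hone : (T : ℝ) * ν.bestMean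
      = ∑ t ∈ Finset.Icc 1 T, ∑ i, P.real {ω | I t ω = i} * ν.bestMean := by
    rw [Finset.sum_congr rfl (g := fun _ => ν.bestMean)]
    · simp
    · intro t ht
      rw [Finset.mem_Icc] at ht
      rw [← Finset.sum_mul, h.sum_measure_action_eq ht.1 ht.2, one_mul]
  rw [regret, integral_finsetSum _ hint, Finset.sum_congr rfl hval, hone,
    ← Finset.sum_sub_distrib]
  simp_rw [← Finset.sum_sub_distrib, ← mul_sub, Finset.mul_sum]
  rw [Finset.sum_comm]
  simp_rw [mul_comm]

/-! ### Expected pulls of suboptimal arms and the regret bounds. -/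

lemma measure_contamination_le [IsProbabilityMeasure P] (h : AttackedUCBRun ν T P ℱ r I c)
    {B C : ℝ} (hB : 0 < B) (hC : expectedContamination P T c ≤ C) :
    P.real {ω | B < ∑ t ∈ Finset.Icc 1 T, |c t ω|} ≤ C / B := by
  have hint : Integrable (fun ω => ∑ t ∈ Finset.Icc 1 T, |c t ω|) P :=
    integrable_finsetSum _ fun t ht =>
      h.integrable_abs_contamination (Finset.mem_Icc.1 ht).1 (Finset.mem_Icc.1 ht).2
  have hM := mul_meas_ge_le_integral_of_nonneg
    (ae_of_all P fun ω => Finset.sum_nonneg fun t _ => abs_nonneg (c t ω)) hint B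
  have hsub : P.real {ω | B < ∑ t ∈ Finset.Icc 1 T, |c t ω|}
      ≤ P.real {ω | B ≤ ∑ t ∈ Finset.Icc 1 T, |c t ω|} :=
    measureReal_mono fun ω (hω : B < _) => show B ≤ _ from hω.le
  rw [le_div_iff₀ hB, mul_comm]
  exact (mul_le_mul_of_nonneg_left hsub hB.le).trans (hM.trans hC)

/-- A late round selects a suboptimal arm that was pulled often with small probability. -/
lemma measure_action_eq_of_pulled_le [IsProbabilityMeasure P] (h : AttackedUCBRun ν T P ℱ r I c)
    {i j : Fin K} (hij : ν.mean i < ν.mean j) {t n : ℕ} (hKt : K < t) (htT : t ≤ T)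
    (hTt : T ≤ t ^ 2) (hn : 72 * Real.log T / (ν.mean j - ν.mean i) ^ 2 ≤ n) :
    P.real {ω | I t ω = i ∧ n < pulls (fun n => I n ω) (t - 1) i}
      ≤ 2 / T + P.real {ω | Real.log T / 2 < ∑ t ∈ Finset.Icc 1 T, |c t ω|} := by
  have ht1 : 1 ≤ t := by omega
  have ht0 : (0 : ℝ) < t := by exact_mod_cast ht1
  have hT0 : (0 : ℝ) < T := by exact_mod_cast (show 0 < T by omega)
  have hL : 0 ≤ Real.log t := Real.log_natCast_nonneg t
  have hlog : Real.log T / 2 ≤ Real.log t := by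
    have h1 : Real.log T ≤ Real.log ((t : ℝ) ^ 2) :=
      Real.log_le_log hT0 (by exact_mod_cast hTt)
    rw [Real.log_pow] at h1
    push_cast at h1
    linarith
  have hlog' : Real.log t ≤ Real.log T := Real.log_le_log ht0 (by exact_mod_cast htT)
  -- The union bound costs a factor `t`, leaving `t ^ (-3)`, which `T ≤ t ^ 2` turns into `1 / T`;
  -- summed over all rounds this stays bounded.
  have hexp : ((t - 1 : ℕ) + 1 : ℝ) * Real.exp (-(4 * Real.log t)) ≤ 1 / T := by
    have e1 : Real.exp (-(4 * Real.log t)) = ((t : ℝ) ^ 4)⁻¹ := by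
      rw [Real.exp_neg, show (4 : ℝ) * Real.log t = Real.log ((t : ℝ) ^ 4) by
        rw [Real.log_pow]; norm_num, Real.exp_log (by positivity)]
    rw [e1, Nat.cast_sub ht1, Nat.cast_one, sub_add_cancel, ← div_eq_mul_inv,
      div_le_div_iff₀ (by positivity) hT0]
    have h1 : (T : ℝ) ≤ (t : ℝ) ^ 2 := by exact_mod_cast hTt
    have h2 : (1 : ℝ) ≤ t := by exact_mod_cast ht1
    calc (t : ℝ) * T ≤ t * t ^ 2 := by gcongr
      _ = 1 * t ^ 3 := by ring
      _ ≤ t * t ^ 3 := by gcongr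
      _ = 1 * t ^ 4 := by ring
  have hDj := (h.measure_deviation_le j (s := -1) (by norm_num) hL
    (show t - 1 ≤ T by omega)).trans hexp
  have hDi := (h.measure_deviation_le i (s := 1) (by norm_num) hL
    (show t - 1 ≤ T by omega)).trans hexp
  set Dj := {ω | √(2 * pulls (fun n => I n ω) (t - 1) j * Real.log t)
      < -1 * centeredSum (fun n => I n ω) (fun n => r n (I n ω) ω) (ν.mean j) (t - 1) j}
    with hDjdef
  set Di := {ω | √(2 * pulls (fun n => I n ω) (t - 1) i * Real.log t)
      < 1 * centeredSum (fun n => I n ω) (fun n => r n (I n ω) ω) (ν.mean i) (t - 1) i}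
    with hDidef
  set E := {ω | Real.log T / 2 < ∑ t ∈ Finset.Icc 1 T, |c t ω|} with hE
  have hsub : {ω | I t ω = i ∧ n < pulls (fun n => I n ω) (t - 1) i} ⊆ Dj ∪ Di ∪ E := by
    rintro ω ⟨hI, hpull⟩
    by_contra hω
    simp only [Set.mem_union, not_or, hDjdef, hDidef, hE, Set.mem_ofPred_eq, not_lt] at hω
    obtain ⟨⟨hj, hi⟩, hc⟩ := hω
    have hpull' : (n : ℝ) < pulls (fun n => I n ω) (t - 1) i := by exact_mod_cast hpull
    refine (h.followsUCB ω).ne_of_concentrated (t := t) (j := j) (c := fun n => c n ω) hKt htT ?_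
      (hc.trans hlog) hij (ν.mean_mem_Icc i).1 (ν.mean_mem_Icc j).2 ?_ ?_ ?_ hI
    · intro k hk hkT
      linarith [(h.contamination_mem k hk hkT ω).1]
    · linarith
    · linarith
    · refine lt_of_le_of_lt (le_trans ?_ hn) hpull'
      gcongr
  calc _ ≤ P.real (Dj ∪ Di ∪ E) := measureReal_mono hsub
    _ ≤ P.real Dj + P.real Di + P.real E :=
      (measureReal_union_le _ _).trans (by gcongr; exact measureReal_union_le _ _)
    _ ≤ 1 / T + 1 / T + P.real E := by gcongr
    _ = _ := by ring

/-- The cut-off `Nat.sqrt T` discards few rounds, yet makes `T ≤ t ^ 2` afterwards; `K ^ 2 ≤ T`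
places it past the round robin. The `4` collects the rounding in `n`, the extra pull in `n + 1`, and
`T * (2 / T)`. -/
lemma sum_measure_action_eq_le [IsProbabilityMeasure P] (h : AttackedUCBRun ν T P ℱ r I c)
    {i j : Fin K} (hij : ν.mean i < ν.mean j) (hKT : K ^ 2 ≤ T) :
    ∑ t ∈ Finset.Icc 1 T, P.real {ω | I t ω = i}
      ≤ √T + 72 * Real.log T / (ν.mean j - ν.mean i) ^ 2 + 4
        + T * P.real {ω | Real.log T / 2 < ∑ t ∈ Finset.Icc 1 T, |c t ω|} := by
  set m := Nat.sqrt T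
  set n := ⌈72 * Real.log T / (ν.mean j - ν.mean i) ^ 2⌉₊
  set q := P.real {ω | Real.log T / 2 < ∑ t ∈ Finset.Icc 1 T, |c t ω|}
  have hq : 0 ≤ q := measureReal_nonneg
  have hmK : K ≤ m := Nat.le_sqrt'.2 hKT
  have hm : (m : ℝ) ≤ √T := Real.nat_sqrt_le_real_sqrt
  have hn : (n : ℝ) ≤ 72 * Real.log T / (ν.mean j - ν.mean i) ^ 2 + 1 :=
    (Nat.ceil_lt_add_one (by have := Real.log_natCast_nonneg T; positivity)).le
  have hmeas : ∀ t ∈ Finset.Icc 1 T, MeasurableSet {ω | I t ω = i} := fun t ht =>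
    ℱ.le _ _ (h.measurableSet_action_eq (Finset.mem_Icc.1 ht).1 (Finset.mem_Icc.1 ht).2 i)
  have hmeas' : ∀ t ∈ Finset.Ioc m T,
      MeasurableSet {ω | I t ω = i ∧ n < pulls (fun n => I n ω) (t - 1) i} := by
    intro t ht
    rw [Finset.mem_Ioc] at ht
    refine (hmeas t (Finset.mem_Icc.2 ⟨by omega, ht.2⟩)).inter ?_
    have hp := (h.measurable_pulls (t := t - 1) (by omega) i).mono (ℱ.le _) le_rfl
    exact_mod_cast measurableSet_lt (measurable_const (a := (n : ℝ))) hp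
  obtain ⟨hi1, he1⟩ := integral_card_filter (P := P) _ (fun t ω => I t ω = i) hmeas
  obtain ⟨hi2, he2⟩ := integral_card_filter (P := P) _
    (fun t ω => I t ω = i ∧ n < pulls (fun n => I n ω) (t - 1) i) hmeas'
  have hmono := integral_mono hi1 ((integrable_const ((m : ℝ) + (n + 1))).add hi2) fun ω => by
    have := pulls_le_add_sum (fun n => I n ω) i m n T
    simp only [Pi.add_apply]
    exact_mod_cast this
  simp only [Pi.add_apply] at hmono
  rw [integral_add (integrable_const _) hi2, he1, he2] at hmono
  simp only [integral_const, probReal_univ, one_smul] at hmono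
  have hsum : ∑ t ∈ Finset.Ioc m T,
      P.real {ω | I t ω = i ∧ n < pulls (fun n => I n ω) (t - 1) i} ≤ T * (2 / T + q) := by
    refine (Finset.sum_le_card_nsmul _ _ (2 / T + q) fun t ht => ?_).trans ?_
    · rw [Finset.mem_Ioc] at ht
      refine h.measure_action_eq_of_pulled_le hij (by omega) ht.2 ?_ (Nat.le_ceil _)
      exact (Nat.lt_succ_sqrt' T).le.trans (Nat.pow_le_pow_left ht.1 2)
    · rw [nsmul_eq_mul, Nat.card_Ioc]
      gcongr
      exact Nat.sub_le _ _
  have h2 : (T : ℝ) * (2 / T + q) ≤ 2 + T * q := by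
    rw [mul_add]
    gcongr
    rw [mul_div_assoc']
    exact div_le_of_le_mul₀ (by positivity) (by norm_num) (by linarith)
  linarith

/-- The regret of a long run, in terms of the probability of a large amount of contamination. -/
lemma regret_le_of_sq_le [IsProbabilityMeasure P] (h : AttackedUCBRun ν T P ℱ r I c) (hK : 1 ≤ K)
    (hKT : K ^ 2 ≤ T) :
    regret ν P T r I ≤ ∑ i, (√T + 72 * Real.log T / (ν.bestMean - ν.mean i) ^ 2 + 4
        + T * P.real {ω | Real.log T / 2 < ∑ t ∈ Finset.Icc 1 T, |c t ω|}) := by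
  obtain ⟨j, hj⟩ := ν.exists_mean_eq_bestMean hK
  rw [h.regret_eq]
  refine Finset.sum_le_sum fun i _ => ?_
  have hlog := Real.log_natCast_nonneg T
  rcases (ν.mean_le_bestMean i).eq_or_lt with hi | hi
  -- An optimal arm costs nothing; in its bound the division by the zero gap evaluates to `0`.
  · rw [hi, sub_self, zero_mul]
    positivity
  · rw [← hj] at hi ⊢
    refine le_trans ?_ (h.sum_measure_action_eq_le hi hKT)
    refine mul_le_of_le_one_left (Finset.sum_nonneg fun _ _ => measureReal_nonneg) ?_
    linarith [(ν.mean_mem_Icc i).1, (ν.mean_mem_Icc j).2]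

lemma regret_nonneg [IsProbabilityMeasure P] (h : AttackedUCBRun ν T P ℱ r I c) :
    0 ≤ regret ν P T r I := by
  rw [h.regret_eq]
  exact Finset.sum_nonneg fun i _ => mul_nonneg (sub_nonneg.2 (ν.mean_le_bestMean i))
    (Finset.sum_nonneg fun _ _ => measureReal_nonneg)

lemma regret_le_horizon [IsProbabilityMeasure P] (h : AttackedUCBRun ν T P ℱ r I c)
    (hK : 1 ≤ K) : regret ν P T r I ≤ T := by
  obtain ⟨j, hj⟩ := ν.exists_mean_eq_bestMean hK
  rw [h.regret_eq]
  calc _ ≤ ∑ i, ∑ t ∈ Finset.Icc 1 T, P.real {ω | I t ω = i} := by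
        refine Finset.sum_le_sum fun i _ => ?_
        refine mul_le_of_le_one_left (Finset.sum_nonneg fun _ _ => measureReal_nonneg) ?_
        linarith [(ν.mean_mem_Icc i).1, (ν.mean_mem_Icc j).2]
    _ = ∑ t ∈ Finset.Icc 1 T, (1 : ℝ) := by
        rw [Finset.sum_comm]
        exact Finset.sum_congr rfl fun t ht =>
          h.sum_measure_action_eq (Finset.mem_Icc.1 ht).1 (Finset.mem_Icc.1 ht).2
    _ = T := by simp

end AttackedUCBRun

/-! ### Asymptotics and conclusion. -/

lemma isLittleO_regretBound {ε : ℝ} (hε : 0 < ε) (b : ℝ) :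
    (fun T : ℕ => √(T : ℝ) + 72 * Real.log T / b + 4 + T * (2 * Real.log T ^ (-ε)))
      =o[atTop] fun T : ℕ => (T : ℝ) := by
  have hsqrt : (fun x : ℝ => √x) =o[atTop] fun x : ℝ => x := by
    refine isLittleO_of_tendsto' ((eventually_gt_atTop 0).mono fun x hx h => absurd h hx.ne') ?_
    simp_rw [Real.sqrt_div_self]
    exact Real.tendsto_sqrt_atTop.inv_tendsto_atTop
  have hlog : (fun x : ℝ => 72 * Real.log x / b) =o[atTop] fun x : ℝ => x := by
    have := Real.isLittleO_log_id_atTop.const_mul_left (72 / b)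
    refine this.congr_left fun x => by ring
  have hconst : (fun _ : ℝ => (4 : ℝ)) =o[atTop] fun x : ℝ => x := isLittleO_const_id_atTop 4
  have hpow : (fun x : ℝ => x * (2 * Real.log x ^ (-ε))) =o[atTop] fun x : ℝ => x := by
    have h1 : Tendsto (fun x : ℝ => 2 * Real.log x ^ (-ε)) atTop (nhds 0) := by
      simpa using ((tendsto_rpow_neg_atTop hε).comp Real.tendsto_log_atTop).const_mul 2
    simpa using (isBigO_refl (fun x : ℝ => x) atTop).mul_isLittleO
      ((isLittleO_one_iff ℝ).2 h1)
  exact (((hsqrt.add hlog).add hconst).add hpow).comp_tendsto tendsto_natCast_atTop_atTop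

theorem corollary1 {K : ℕ} (hK : 1 ≤ K) (ν : StochasticBandit K)
    (ε : ℝ) (hε0 : 0 < ε) (hε1 : ε < 1) :
    ∃ g : ℕ → ℝ, (g =o[atTop] fun T : ℕ => (T : ℝ)) ∧
      ∀ (T : ℕ) (Ω : Type*) (mΩ : MeasurableSpace Ω) (P : Measure Ω) (_ : IsProbabilityMeasure P)
        (ℱ : Filtration ℕ mΩ) (r : ℕ → Fin K → Ω → ℝ) (I : ℕ → Ω → Fin K) (c : ℕ → Ω → ℝ),
        AttackedUCBRun ν T P ℱ r I c →
        expectedContamination P T c ≤ Real.log (T : ℝ) ^ (1 - ε) →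
        |regret ν P T r I| ≤ g T := by
  let f : ℕ → ℝ := fun T => ∑ i, (√(T : ℝ) + 72 * Real.log T / (ν.bestMean - ν.mean i) ^ 2 + 4
    + T * (2 * Real.log T ^ (-ε)))
  -- For `T ≥ K ^ 2 + 2` both `K ^ 2 ≤ T` and `log T > 0` hold; shorter horizons use the trivial
  -- bound `T`.
  refine ⟨fun T => if T < K ^ 2 + 2 then (T : ℝ) else f T, ?_, ?_⟩
  · refine (IsLittleO.sum (s := Finset.univ) fun i _ =>
      isLittleO_regretBound hε0 ((ν.bestMean - ν.mean i) ^ 2)).congr' ?_ EventuallyEq.rfl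
    filter_upwards [eventually_ge_atTop (K ^ 2 + 2)] with T hT
    simp [f, not_lt.2 hT]
  · intro T Ω mΩ P _ ℱ r I c h hc
    rw [abs_of_nonneg h.regret_nonneg]
    dsimp only
    split_ifs with hT
    · exact h.regret_le_horizon hK
    · have hlog : 0 < Real.log T := Real.log_pos (by exact_mod_cast (show 1 < T by omega))
      refine (h.regret_le_of_sq_le hK (by omega)).trans (Finset.sum_le_sum fun i _ => ?_)
      gcongr
      refine (h.measure_contamination_le (half_pos hlog) hc).trans_eq ?_
      rw [sub_eq_add_neg, Real.rpow_add hlog, Real.rpow_one]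
      field_simp
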